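/- Let $G$ be a finite connected simple graph and $X\subseteq V(G)$. Vertices $x,y$ of $G$ are $X$-visible if there is a shortest $x,y$-path in $G$ none of whose internal vertices belongs to $X$. The set $X$ is a dual mutual-visibility set of $G$ if any two vertices of $X$ are $X$-visible and any two vertices of $V(G)\setminus X$ are $X$-visible. Let $\mu_{\rm d}(G)$ be the largest cardinality of a dual mutual-visibility set of $G$. The dual visibility spectrum of $G$ is the vector $(r_0,r_1,\dots,r_k)$, where $k=\mu_{\rm d}(G)$ and $r_i$ is the number of dual mutual-visibility sets of $G$ of cardinality $i$. **Theorem.** For every integer $k\ge 0$ and all nonnegative integers $r_0,r_1,\dots,r_k$ with $r_0=1$ and $r_k>0$, there exists a finite connected simple graph $G$ such that $\mu_{\rm d}(G)=k$ and the dual visibility spectrum of $G$ is $(1,r_1,\dots,r_k)$. -/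

import Mathlib

namespace SimpleGraph

variable {V : Type*}

/-- `x` and `y` are `X`-visible in `G`: some shortest `x,y`-path has no internal vertex in `X`. -/
def XVisible (G : SimpleGraph V) (X : Finset V) (x y : V) : Prop :=
  ∃ p : G.Walk x y, p.IsPath ∧ p.length = G.dist x y ∧
    ∀ z ∈ p.support, z ≠ x → z ≠ y → z ∉ X

/-- `X` is a dual mutual-visibility set of `G`: any two vertices of `X`, and any two vertices
outside `X`, are `X`-visible. -/
def IsDualMutualVisibilitySet (G : SimpleGraph V) (X : Finset V) : Prop :=
  (∀ x ∈ X, ∀ y ∈ X, G.XVisible X x y) ∧ (∀ x ∉ X, ∀ y ∉ X, G.XVisible X x y)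

open Classical in
/-- The finite family of all dual mutual-visibility sets of a finite graph. -/
noncomputable def dualMutualVisibilitySets [Fintype V] (G : SimpleGraph V) :
    Finset (Finset V) :=
  Finset.univ.filter fun X => G.IsDualMutualVisibilitySet X

/-- The dual mutual-visibility number `μ_d(G)`: the largest cardinality of a dual
mutual-visibility set. -/
noncomputable def dualMutualVisibilityNumber [Fintype V] (G : SimpleGraph V) : ℕ :=
  G.dualMutualVisibilitySets.sup Finset.card

/-- The number of dual mutual-visibility sets of size `i`. -/
noncomputable def dualVisibilityCount [Fintype V] (G : SimpleGraph V) (i : ℕ) : ℕ :=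
  (G.dualMutualVisibilitySets.filter fun X => X.card = i).card

/-- The dual visibility spectrum `(r_0, …, r_k)`, where `k = μ_d(G)` and `r_i` is the number of
dual mutual-visibility sets of size `i`, as a list of length `k + 1`. -/
noncomputable def dualVisibilitySpectrum [Fintype V] (G : SimpleGraph V) : List ℕ :=
  List.ofFn fun i : Fin (G.dualMutualVisibilityNumber + 1) => G.dualVisibilityCount i

end SimpleGraph

open SimpleGraph

-- Visibility at distance two and rerouting of walks

section Visibility

variable {V : Type*} {G : SimpleGraph V} {X : Finset V}

namespace SimpleGraph

-- The graph is built so that its dual mutual-visibility sets are the empty set and prescribed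
-- disjoint cliques, the blocks: `r i` of them of size `i`. Petersen graphs rooted at all auxiliary
-- vertices keep these out of every such set (`base_notMem`). Vertices attached to elements then
-- force a set to contain whole blocks (`mem_of_mem_block`) and to meet only one
-- (`block_eq_of_mem`). Conversely a block is a clique, and its outside neighbours are pair
-- vertices. Two of these share a hub, unless they are `(a, b)` and `(b, a)`; then `a` and `b` lie
-- in different blocks, so one of them avoids the given block. Shortest paths can thus be rerouted
-- around it (`Walk.exists_avoiding`).

/-- Visible vertices at distance two have a common neighbour outside `X`. -/
theorem XVisible.exists_common_neighbor {x y v : V} (h : G.XVisible X x y) (hne : x ≠ y)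
    (hadj : ¬ G.Adj x y) (hx : G.Adj x v) (hy : G.Adj v y) :
    ∃ z, z ∉ X ∧ G.Adj x z ∧ G.Adj z y := by
  obtain ⟨p, -, hlen, hX⟩ := h
  have hle : p.length ≤ 2 := hlen ▸ dist_le (Walk.cons hx (Walk.cons hy Walk.nil))
  match p, hle, hX with
  | .nil, _, _ => exact absurd rfl hne
  | .cons h₁ .nil, _, _ => exact absurd h₁ hadj
  | .cons (v := z) h₁ (.cons h₂ .nil), _, hX =>
    exact ⟨z, hX z (by simp) h₁.ne' h₂.ne, h₁, h₂⟩
  | .cons _ (.cons _ (.cons _ _)), hle, _ => simp at hle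

/-- A vertex with three neighbours, pairwise non-adjacent and with no other pairwise common
neighbour, lies in no dual mutual-visibility set: two of the three neighbours are on the same
side of the set. -/
theorem IsDualMutualVisibilitySet.notMem_of_claw (hX : G.IsDualMutualVisibilitySet X) {v : V}
    (y : Fin 3 → V) (hinj : Function.Injective y) (hy : ∀ i, G.Adj v (y i))
    (hnadj : ∀ i j, ¬ G.Adj (y i) (y j))
    (huniq : ∀ i j z, i ≠ j → G.Adj (y i) z → G.Adj z (y j) → z = v) : v ∉ X := by
  intro hv
  have key : ∀ i j, i ≠ j → ¬ G.XVisible X (y i) (y j) := by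
    intro i j hij hvis
    obtain ⟨z, hz, h₁, h₂⟩ := hvis.exists_common_neighbor (hinj.ne hij) (hnadj i j)
      (hy i).symm (hy j)
    exact hz (huniq i j z hij h₁ h₂ ▸ hv)
  have hside : ∀ i j, i ≠ j → ¬ (y i ∈ X ↔ y j ∈ X) := by
    intro i j hij hiff
    by_cases h : y i ∈ X
    · exact key i j hij (hX.1 _ h _ (hiff.1 h))
    · exact key i j hij (hX.2 _ h _ fun h' => h (hiff.2 h'))
  have h₁ := hside 0 1 (by decide)
  have h₂ := hside 0 2 (by decide)
  have h₃ := hside 1 2 (by decide)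
  tauto

theorem XVisible.of_adj {x y : V} (h : G.Adj x y) : G.XVisible X x y :=
  ⟨h.toWalk, h.toWalk.isPath_of_length_eq_dist (by simp [dist_eq_one_iff_adj.2 h]),
    by simp [dist_eq_one_iff_adj.2 h], by simp⟩

theorem XVisible.refl (x : V) : G.XVisible X x x :=
  ⟨Walk.nil, by simp, by simp, by simp⟩

/-- If any two vertices outside `X` with neighbours in `X` are joined outside `X` by a walk of
length two, then walks can be rerouted around `X` without becoming longer. -/
theorem Walk.exists_avoiding
    (hX : ∀ x w, x ∉ X → w ∉ X → (∃ a ∈ X, G.Adj x a) → (∃ a ∈ X, G.Adj w a) →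
      x = w ∨ ∃ z ∉ X, G.Adj x z ∧ G.Adj z w)
    {z y : V} (p : G.Walk z y) (hy : y ∉ X) :
    (z ∉ X → ∃ q : G.Walk z y, q.length ≤ p.length ∧ ∀ u ∈ q.support, u ∉ X) ∧
    (z ∈ X → ∀ x, x ∉ X → (∃ a ∈ X, G.Adj x a) →
      ∃ q : G.Walk x y, q.length ≤ p.length + 1 ∧ ∀ u ∈ q.support, u ∉ X) := by
  -- While the walk is inside `X`, `x` remembers the last vertex before entry. The stretch from `x`
  -- to the exit has at least two edges, so two edges can replace it.
  induction p with
  | nil => exact ⟨fun _ => ⟨Walk.nil, by simp, by simpa using hy⟩, fun h => absurd h hy⟩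
  | @cons z z' y hzz' p ih =>
    obtain ⟨ih₁, ih₂⟩ := ih hy
    refine ⟨fun hz => ?_, fun hz x hx hxa => ?_⟩
    · by_cases hz' : z' ∈ X
      · exact ih₂ hz' z hz ⟨z', hz', hzz'⟩
      · obtain ⟨q, hq, hqX⟩ := ih₁ hz'
        refine ⟨Walk.cons hzz' q, by simpa using hq, ?_⟩
        simpa [hz] using hqX
    · by_cases hz' : z' ∈ X
      · obtain ⟨q, hq, hqX⟩ := ih₂ hz' x hx hxa
        exact ⟨q, by simp; omega, hqX⟩
      · obtain ⟨q, hq, hqX⟩ := ih₁ hz'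
        obtain rfl | ⟨m, hm, h₁, h₂⟩ := hX x z' hx hz' hxa ⟨z, hz, hzz'.symm⟩
        · exact ⟨q, by simp; omega, hqX⟩
        · refine ⟨Walk.cons h₁ (Walk.cons h₂ q), by simpa using hq, ?_⟩
          simpa [hx, hm] using hqX

theorem Connected.xVisible_of_notMem (hG : G.Connected)
    (hX : ∀ x w, x ∉ X → w ∉ X → (∃ a ∈ X, G.Adj x a) → (∃ a ∈ X, G.Adj w a) →
      x = w ∨ ∃ z ∉ X, G.Adj x z ∧ G.Adj z w)
    {x y : V} (hx : x ∉ X) (hy : y ∉ X) : G.XVisible X x y := by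
  obtain ⟨p, hp⟩ := hG.exists_walk_length_eq_dist x y
  obtain ⟨q, hq, hqX⟩ := (p.exists_avoiding hX hy).1 hx
  have hlen : q.length = G.dist x y := le_antisymm (hp ▸ hq) (dist_le q)
  exact ⟨q, q.isPath_of_length_eq_dist hlen, hlen, fun z hz _ _ => hqX z hz⟩

end SimpleGraph

end Visibility

-- The block graph and its adjacencies

namespace BlockGraph

/-- The Petersen graph: outer cycle on `0, …, 4`, inner pentagram on `5, …, 9`. -/
def Petersen (x y : Fin 10) : Prop :=
  (x, y) ∈ ([(0, 1), (1, 2), (2, 3), (3, 4), (4, 0), (5, 7), (7, 9), (9, 6), (6, 8), (8, 5),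
    (0, 5), (1, 6), (2, 7), (3, 8), (4, 9), (1, 0), (2, 1), (3, 2), (4, 3), (0, 4), (7, 5),
    (9, 7), (6, 9), (8, 6), (5, 8), (5, 0), (6, 1), (7, 2), (8, 3), (9, 4)] :
    List (Fin 10 × Fin 10))

instance : DecidableRel Petersen := fun _ _ => inferInstanceAs (Decidable (_ ∈ _))

theorem Petersen.symm : ∀ {x y : Fin 10}, Petersen x y → Petersen y x := by decide

theorem Petersen.ne : ∀ {x y : Fin 10}, Petersen x y → x ≠ y := by decide

theorem Petersen.exists_neighbors : ∀ x : Fin 10, ∃ y₀ y₁ y₂ : Fin 10,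
    (y₀ ≠ y₁ ∧ y₀ ≠ y₂ ∧ y₁ ≠ y₂) ∧ Petersen x y₀ ∧ Petersen x y₁ ∧ Petersen x y₂ := by
  decide

theorem Petersen.not_triangle : ∀ x y z : Fin 10, Petersen x y → Petersen x z →
    ¬ Petersen y z := by decide

theorem Petersen.eq_of_common : ∀ x y y' z : Fin 10, y ≠ y' → Petersen x y → Petersen x y' →
    Petersen y z → Petersen z y' → z = x := by decide

theorem Petersen.root_near : ∀ x : Fin 10, x = 0 ∨ Petersen x 0 ∨
    ∃ y, Petersen x y ∧ Petersen y 0 := by decide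

/-- Vertices that belong to no dual mutual-visibility set; a copy of the Petersen graph is
attached to each of them. -/
inductive Base (A : Type) : Type
  | center : Base A
  | pair : A × A → Base A
  | hub : A × A → A × A → Base A
  deriving Fintype

/-- The vertices: the elements of the blocks, and the Petersen graphs rooted at the base. -/
abbrev Vertex (A : Type) : Type := A ⊕ Base A × Fin 10

variable {A J : Type} (bl : A → J)

/-- The edges of the block graph, in one orientation each (or both). -/
inductive Link : Vertex A → Vertex A → Prop
  | block (a b : A) : bl a = bl b → Link (.inl a) (.inl b)
  | fst (a b : A) : (a = b ∨ bl a ≠ bl b) → Link (.inl a) (.inr (.pair (a, b), 0))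
  | snd (a b : A) : (a = b ∨ bl a ≠ bl b) → Link (.inl b) (.inr (.pair (a, b), 0))
  | hubLeft (u v : A × A) : Link (.inr (.pair u, 0)) (.inr (.hub u v, 0))
  | hubRight (u v : A × A) : v ≠ u.swap → Link (.inr (.pair v, 0)) (.inr (.hub u v, 0))
  | center (u v : A × A) : Link (.inr (.hub u v, 0)) (.inr (.center, 0))
  | gadget (b : Base A) (x y : Fin 10) : Petersen x y → Link (.inr (b, x)) (.inr (b, y))

/-- The graph whose dual mutual-visibility sets are the empty set and the fibres of `bl`. -/
def graph : SimpleGraph (Vertex A) := SimpleGraph.fromRel (Link bl)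

variable {bl}

theorem Link.adj {x y : Vertex A} (h : Link bl x y) (hne : x ≠ y) : (graph bl).Adj x y :=
  (SimpleGraph.fromRel_adj _ _ _).2 ⟨hne, Or.inl h⟩

theorem adj_gadget_iff {b : Base A} {x y : Fin 10} :
    (graph bl).Adj (.inr (b, x)) (.inr (b, y)) ↔ Petersen x y := by
  constructor
  · rw [graph, SimpleGraph.fromRel_adj]
    rintro ⟨-, h | h⟩
    · cases h
      assumption
    · cases h
      exact Petersen.symm ‹_›
  · intro h
    exact (Link.gadget b x y h).adj (by simpa using h.ne)

theorem eq_of_adj_gadget {b : Base A} {x : Fin 10} (hx : x ≠ 0) {z : Vertex A}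
    (h : (graph bl).Adj (.inr (b, x)) z) : ∃ y, z = .inr (b, y) := by
  rw [graph, SimpleGraph.fromRel_adj] at h
  obtain ⟨-, h | h⟩ := h <;> cases h <;> first | exact ⟨_, rfl⟩ | exact absurd rfl hx

theorem adj_element_iff {a : A} {z : Vertex A} :
    (graph bl).Adj (.inl a) z ↔ (∃ b, a ≠ b ∧ bl a = bl b ∧ z = .inl b) ∨
      ∃ u : A × A, (u.1 = u.2 ∨ bl u.1 ≠ bl u.2) ∧ (a = u.1 ∨ a = u.2) ∧
        z = .inr (.pair u, 0) := by
  constructor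
  · rw [graph, SimpleGraph.fromRel_adj]
    rintro ⟨hne, h | h⟩
    · cases h with
      | block _ b hb => exact Or.inl ⟨b, fun h => hne (h ▸ rfl), hb, rfl⟩
      | fst _ b hb => exact Or.inr ⟨(a, b), hb, Or.inl rfl, rfl⟩
      | snd b _ hb => exact Or.inr ⟨(b, a), hb, Or.inr rfl, rfl⟩
    · cases h with
      | block b _ hb => exact Or.inl ⟨b, fun h => hne (h ▸ rfl), hb.symm, rfl⟩
  · rintro (⟨b, hne, hb, rfl⟩ | ⟨⟨c, d⟩, hv, rfl | rfl, rfl⟩)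
    · exact (Link.block a b hb).adj (by simpa using hne)
    · exact (Link.fst _ _ hv).adj (by simp)
    · exact (Link.snd _ _ hv).adj (by simp)

theorem adj_pair {u : A × A} {z : Vertex A} (h : (graph bl).Adj (.inr (.pair u, 0)) z) :
    (∃ a, (a = u.1 ∨ a = u.2) ∧ z = .inl a) ∨
      (∃ v w, (u = v ∨ u = w ∧ w ≠ v.swap) ∧ z = .inr (.hub v w, 0)) ∨
      ∃ y, y ≠ 0 ∧ z = .inr (.pair u, y) := by
  rw [graph, SimpleGraph.fromRel_adj] at h
  obtain ⟨hne, h | h⟩ := h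
  · cases h with
    | hubLeft _ v => exact Or.inr (Or.inl ⟨u, v, Or.inl rfl, rfl⟩)
    | hubRight v _ hv => exact Or.inr (Or.inl ⟨v, u, Or.inr ⟨rfl, hv⟩, rfl⟩)
    | gadget _ _ y hy => exact Or.inr (Or.inr ⟨y, (Petersen.ne hy).symm, rfl⟩)
  · cases h with
    | fst a b => exact Or.inl ⟨a, Or.inl rfl, rfl⟩
    | snd a b => exact Or.inl ⟨b, Or.inr rfl, rfl⟩
    | gadget _ y _ hy => exact Or.inr (Or.inr ⟨y, Petersen.ne hy, rfl⟩)

/-- The Petersen graph is cubic of girth five, so each of its vertices is the centre of a claw as in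
`notMem_of_claw`. -/
theorem base_notMem {X : Finset (Vertex A)} (hX : (graph bl).IsDualMutualVisibilitySet X)
    (b : Base A) (x : Fin 10) : .inr (b, x) ∉ X := by
  obtain ⟨y₀, y₁, y₂, ⟨h₀₁, h₀₂, h₁₂⟩, h₀, h₁, h₂⟩ := Petersen.exists_neighbors x
  let y : Fin 3 → Fin 10 := ![y₀, y₁, y₂]
  have hy : ∀ i, Petersen x (y i) := by
    intro i
    fin_cases i <;> assumption
  have hinj : Function.Injective y := by
    intro i j
    fin_cases i <;> fin_cases j <;> simp [y, h₀₁, h₀₂, h₁₂, h₀₁.symm, h₀₂.symm, h₁₂.symm]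
  refine hX.notMem_of_claw (fun i => .inr (b, y i)) (fun i j h => hinj (by simpa using h))
    (fun i => adj_gadget_iff.2 (hy i))
    (fun i j h => Petersen.not_triangle x _ _ (hy i) (hy j) (adj_gadget_iff.1 h)) ?_
  intro i j z hij h₁ h₂
  -- Only the root has neighbours outside its copy, and at most one of `y i`, `y j` is the root.
  have hz : ∃ w, z = .inr (b, w) := by
    by_cases h : y i = 0
    · exact eq_of_adj_gadget (fun h' => hij (hinj (h.trans h'.symm))) h₂.symm
    · exact eq_of_adj_gadget h h₁
  obtain ⟨w, rfl⟩ := hz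
  rw [Petersen.eq_of_common x (y i) (y j) w (hinj.ne hij) (hy i) (hy j)
    (adj_gadget_iff.1 h₁) (adj_gadget_iff.1 h₂)]

/-- A dual mutual-visibility set contains each block entirely or not at all. -/
theorem mem_of_mem_block {X : Finset (Vertex A)} (hX : (graph bl).IsDualMutualVisibilitySet X)
    {a s : A} (h : bl a = bl s) (hs : .inl s ∈ X) : .inl a ∈ X := by
  by_contra ha
  have has : a ≠ s := fun h => ha (h ▸ hs)
  -- The vertex of `(s, s)` has `s` as its only element neighbour, so `s` is its only common
  -- neighbour with `a`.
  have hvis := hX.2 _ ha _ (base_notMem hX (.pair (s, s)) 0)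
  obtain ⟨z, hz, h₁, h₂⟩ := hvis.exists_common_neighbor (v := .inl s) (by simp)
    (by
      rw [adj_element_iff]
      rintro (⟨b, -, -, hb⟩ | ⟨u, -, hu, hb⟩)
      · simp at hb
      · simp only [Sum.inr.injEq, Prod.mk.injEq, Base.pair.injEq, and_true] at hb
        subst hb
        simp [has] at hu)
    (adj_element_iff.2 (Or.inl ⟨s, has, h, rfl⟩))
    (adj_element_iff.2 (Or.inr ⟨(s, s), by simp, by simp, rfl⟩))
  obtain ⟨c, hc, rfl⟩ | ⟨v, w, -, rfl⟩ | ⟨y, hy, rfl⟩ := adj_pair h₂.symm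
  · obtain rfl : c = s := by simpa using hc
    exact hz hs
  · rw [adj_element_iff] at h₁
    simp at h₁
  · rw [adj_element_iff] at h₁
    simp [hy] at h₁

/-- A dual mutual-visibility set meets at most one block. -/
theorem block_eq_of_mem {X : Finset (Vertex A)} (hX : (graph bl).IsDualMutualVisibilitySet X)
    {a b : A} (ha : .inl a ∈ X) (hb : .inl b ∈ X) : bl a = bl b := by
  by_contra h
  have hab : a ≠ b := fun h' => h (h' ▸ rfl)
  -- No hub joins swapped pairs, so `a` and `b` are the only common neighbours here.
  have hvis := hX.2 _ (base_notMem hX (.pair (a, b)) 0) _ (base_notMem hX (.pair (b, a)) 0)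
  obtain ⟨z, hz, h₁, h₂⟩ := hvis.exists_common_neighbor (v := .inl a) (by simp [hab])
    (fun h' => by
      have := adj_pair h'
      simp [hab.symm] at this)
    (adj_element_iff.2 (Or.inr ⟨(a, b), by simp [h], by simp, rfl⟩)).symm
    (adj_element_iff.2 (Or.inr ⟨(b, a), by simp [Ne.symm h], by simp, rfl⟩))
  obtain ⟨c, hc, rfl⟩ | ⟨v, w, hvw, rfl⟩ | ⟨y, hy, rfl⟩ := adj_pair h₁
  · obtain rfl | rfl := hc
    · exact hz ha
    · exact hz hb
  · have h₃ := adj_pair h₂.symm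
    simp only [reduceCtorEq, and_false, exists_false, Sum.inr.injEq, Prod.mk.injEq,
      Base.hub.injEq, and_true, false_or, or_false, false_and] at h₃
    obtain ⟨v', w', h₃, rfl, rfl⟩ := h₃
    obtain rfl | ⟨rfl, hw⟩ := hvw <;> obtain h₃ | ⟨h₃, hw'⟩ := h₃
    · simp [hab.symm] at h₃
    · exact hw' (by simp [← h₃])
    · exact hw (by simp [← h₃])
    · simp [hab.symm] at h₃
  · have h₃ := adj_pair h₂.symm
    simp [hab] at h₃

theorem reachable_center (x : Vertex A) : (graph bl).Reachable x (.inr (.center, 0)) := by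
  have hhub : ∀ u v : A × A,
      (graph bl).Reachable (.inr (.hub u v, 0)) (.inr (.center, 0)) := fun u v =>
    ((Link.center u v).adj (by simp)).reachable
  have hpair : ∀ u : A × A, (graph bl).Reachable (.inr (.pair u, 0)) (.inr (.center, 0)) :=
    fun u => ((Link.hubLeft u u).adj (by simp)).reachable.trans (hhub u u)
  have hroot : ∀ b : Base A, (graph bl).Reachable (.inr (b, 0)) (.inr (.center, 0))
    | .center => .rfl
    | .pair u => hpair u
    | .hub u v => hhub u v
  obtain a | ⟨b, x⟩ := x
  · exact ((Link.fst a a (Or.inl rfl)).adj (by simp)).reachable.trans (hpair _)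
  · refine .trans ?_ (hroot b)
    obtain rfl | h | ⟨y, h, h'⟩ := Petersen.root_near x
    · rfl
    · exact (adj_gadget_iff.2 h).reachable
    · exact (adj_gadget_iff.2 h).reachable.trans (adj_gadget_iff.2 h').reachable

theorem graph_connected : (graph bl).Connected :=
  haveI : Nonempty (Vertex A) := ⟨.inr (.center, 0)⟩
  ⟨fun x y => (reachable_center x).trans (reachable_center y).symm⟩

-- Blocks are exactly the nonempty candidates

variable [Fintype A]

open Classical in
variable (bl) in
/-- The fibre of `bl` over `j`, as a set of vertices. -/
noncomputable def block (j : J) : Finset (Vertex A) :=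
  (Finset.univ.filter fun a => bl a = j).map .inl

theorem mem_block {j : J} {x : Vertex A} : x ∈ block bl j ↔ ∃ a, bl a = j ∧ x = .inl a := by
  simp [block, eq_comm]

theorem pair_of_adj_block {j : J} {x : Vertex A} (hx : x ∉ block bl j)
    (h : ∃ s ∈ block bl j, (graph bl).Adj x s) :
    ∃ u : A × A, (u.1 = u.2 ∨ bl u.1 ≠ bl u.2) ∧ x = .inr (.pair u, 0) := by
  obtain ⟨s, hs, hadj⟩ := h
  obtain ⟨a, rfl, rfl⟩ := mem_block.1 hs
  obtain ⟨b, -, hb, rfl⟩ | ⟨u, hu, -, rfl⟩ := adj_element_iff.1 hadj.symm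
  · exact absurd (mem_block.2 ⟨b, hb.symm, rfl⟩) hx
  · exact ⟨u, hu, rfl⟩

theorem isDualMutualVisibilitySet_block (j : J) :
    (graph bl).IsDualMutualVisibilitySet (block bl j) := by
  refine ⟨fun x hx y hy => ?_, fun x hx y hy => ?_⟩
  · obtain ⟨a, rfl, rfl⟩ := mem_block.1 hx
    obtain ⟨b, hb, rfl⟩ := mem_block.1 hy
    by_cases hab : a = b
    · subst hab
      exact .refl _
    · exact .of_adj (adj_element_iff.2 (Or.inl ⟨b, hab, hb.symm, rfl⟩))
  · refine graph_connected.xVisible_of_notMem ?_ hx hy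
    intro x w hx hw hxa hwa
    obtain ⟨u, hu, rfl⟩ := pair_of_adj_block hx hxa
    obtain ⟨v, hv, rfl⟩ := pair_of_adj_block hw hwa
    by_cases huv : v = u.swap
    · subst huv
      obtain ⟨c, d⟩ := u
      obtain hcd | hcd := hu
      · simp only at hcd
        subst hcd
        exact Or.inl rfl
      · right
        have hc : ∀ e, (e = c ∨ e = d) → bl e ≠ j → ∃ z ∉ block bl j,
            (graph bl).Adj (.inr (.pair (c, d), 0)) z ∧
            (graph bl).Adj z (.inr (.pair (c, d).swap, 0)) := fun e he hej =>
          ⟨.inl e, by simpa [mem_block] using hej,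
            (adj_element_iff.2 (Or.inr ⟨(c, d), Or.inr hcd, he, rfl⟩)).symm,
            adj_element_iff.2 (Or.inr ⟨(d, c), Or.inr (Ne.symm hcd), he.symm, rfl⟩)⟩
        by_cases hcj : bl c = j
        · exact hc d (Or.inr rfl) fun h => hcd (hcj.trans h.symm)
        · exact hc c (Or.inl rfl) hcj
    · exact Or.inr ⟨.inr (.hub u v, 0), by simp [mem_block], (Link.hubLeft u v).adj (by simp),
        ((Link.hubRight u v huv).adj (by simp)).symm⟩

theorem exists_eq_block {X : Finset (Vertex A)} (hX : (graph bl).IsDualMutualVisibilitySet X)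
    (hne : X.Nonempty) : ∃ j, X = block bl j := by
  obtain ⟨s | ⟨b, x⟩, hs⟩ := hne
  · refine ⟨bl s, Finset.ext fun x => ?_⟩
    rw [mem_block]
    constructor
    · intro hx
      obtain a | ⟨b, x⟩ := x
      · exact ⟨a, block_eq_of_mem hX hx hs, rfl⟩
      · exact absurd hx (base_notMem hX b x)
    · rintro ⟨a, ha, rfl⟩
      exact mem_of_mem_block hX ha hs
  · exact absurd hs (base_notMem hX b x)

-- Counting the blocks

section Spectrum

variable {k : ℕ} (r : Fin (k + 1) → ℕ)

/-- The blocks: `r i` of them of size `i`, for each `i`. -/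
abbrev Index : Type := Σ i : Fin (k + 1), Fin (r i)

/-- The elements of the blocks. -/
abbrev Element : Type := Σ j : Index r, Fin j.1

/-- The block of an element. -/
abbrev blockOf : Element r → Index r := Sigma.fst

theorem card_block (j : Index r) : (block (blockOf r) j).card = j.1 := by
  have : block (blockOf r) j = (Finset.univ : Finset (Fin j.1)).map
      ((Function.Embedding.sigmaMk j).trans .inl) := by
    ext x
    rw [mem_block]
    simp only [Finset.mem_map, Finset.mem_univ, true_and]
    constructor
    · rintro ⟨⟨j, y⟩, rfl, rfl⟩
      exact ⟨y, rfl⟩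
    · rintro ⟨y, rfl⟩
      exact ⟨⟨j, y⟩, rfl, rfl⟩
  rw [this]
  simp

variable {r}

/-- Nonempty fibres over distinct indices are disjoint; `r 0 = 1` leaves a single index with empty
fibre, which accounts for the empty set. -/
theorem block_injective (hr0 : r 0 = 1) : Function.Injective (block (blockOf r)) := by
  rintro ⟨i, x⟩ ⟨i', x'⟩ h
  have hcard := congrArg Finset.card h
  rw [card_block, card_block] at hcard
  obtain rfl : i = i' := Fin.ext hcard
  by_cases hi : i = 0
  · subst hi
    congr 1
    exact Fin.ext (by omega)
  · have hpos : 0 < (i : ℕ) := Nat.pos_of_ne_zero fun h' => hi (Fin.ext h')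
    have hmem : Sum.inl ⟨⟨i, x⟩, ⟨0, hpos⟩⟩ ∈ block (blockOf r) ⟨i, x⟩ :=
      mem_block.2 ⟨_, rfl, rfl⟩
    rw [h] at hmem
    obtain ⟨a, ha, hxa⟩ := mem_block.1 hmem
    rw [← ha, ← Sum.inl.inj hxa]

theorem mem_dualMutualVisibilitySets_iff (hr0 : r 0 = 1) {X : Finset (Vertex (Element r))} :
    X ∈ (graph (blockOf r)).dualMutualVisibilitySets ↔ ∃ j, block (blockOf r) j = X := by
  simp only [dualMutualVisibilitySets, Finset.mem_filter, Finset.mem_univ, true_and]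
  constructor
  · intro hX
    obtain rfl | hne := X.eq_empty_or_nonempty
    · refine ⟨⟨0, ⟨0, by omega⟩⟩, Finset.card_eq_zero.1 ?_⟩
      rw [card_block]
      rfl
    · obtain ⟨j, hj⟩ := exists_eq_block hX hne
      exact ⟨j, hj.symm⟩
  · rintro ⟨j, rfl⟩
    exact isDualMutualVisibilitySet_block j

theorem dualMutualVisibilityNumber_graph (hr0 : r 0 = 1) (hrk : 0 < r (Fin.last k)) :
    (graph (blockOf r)).dualMutualVisibilityNumber = k := by
  apply le_antisymm
  · refine Finset.sup_le fun X hX => ?_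
    obtain ⟨j, rfl⟩ := (mem_dualMutualVisibilitySets_iff hr0).1 hX
    rw [card_block]
    exact Nat.lt_succ_iff.1 j.1.2
  · have h := Finset.le_sup (f := Finset.card) ((mem_dualMutualVisibilitySets_iff hr0).2
      ⟨⟨Fin.last k, ⟨0, hrk⟩⟩, rfl⟩)
    rwa [card_block] at h

theorem dualVisibilityCount_graph (hr0 : r 0 = 1) (i : Fin (k + 1)) :
    (graph (blockOf r)).dualVisibilityCount i = r i := by
  have : (graph (blockOf r)).dualMutualVisibilitySets.filter (fun X => X.card = (i : ℕ)) =
      (Finset.univ : Finset (Fin (r i))).map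
        ((Function.Embedding.sigmaMk i).trans ⟨_, block_injective hr0⟩) := by
    ext X
    rw [Finset.mem_filter, mem_dualMutualVisibilitySets_iff hr0]
    simp only [Finset.mem_map, Finset.mem_univ, true_and, Function.Embedding.trans_apply,
      Function.Embedding.sigmaMk_apply, Function.Embedding.coeFn_mk]
    constructor
    · rintro ⟨⟨⟨i', x⟩, rfl⟩, hcard⟩
      rw [card_block] at hcard
      obtain rfl : i' = i := Fin.ext hcard
      exact ⟨x, rfl⟩
    · rintro ⟨x, rfl⟩
      exact ⟨⟨_, rfl⟩, card_block r _⟩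
  rw [dualVisibilityCount, this]
  simp

end Spectrum

end BlockGraph

theorem theorem4p1 (k : ℕ) (r : Fin (k + 1) → ℕ) (hr0 : r 0 = 1)
    (hrk : 0 < r (Fin.last k)) :
    ∃ (V : Type) (_ : Fintype V) (G : SimpleGraph V), G.Connected ∧
      G.dualMutualVisibilityNumber = k ∧ G.dualVisibilitySpectrum = List.ofFn r := by
  have hk := BlockGraph.dualMutualVisibilityNumber_graph hr0 hrk
  refine ⟨BlockGraph.Vertex (BlockGraph.Element r), inferInstance,
    BlockGraph.graph (BlockGraph.blockOf r), BlockGraph.graph_connected, hk, ?_⟩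
  refine List.ext_getElem (by simp [dualVisibilitySpectrum, hk]) fun i h₁ h₂ => ?_
  simp only [dualVisibilitySpectrum, List.getElem_ofFn]
  exact BlockGraph.dualVisibilityCount_graph hr0 ⟨i, by simpa using h₂⟩
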